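/- A pattern matrix is a matrix with entries in the set of symbols $\{0,*,?\}$. The pattern class of $\mathcal M\in\{0,*,?\}^{r\times q}$ is $$\mathcal P(\mathcal M)=\{M\in\mathbb R^{r\times q} : M_{ij}=0 \text{ if } \mathcal M_{ij}=0,\ M_{ij}\neq 0 \text{ if } \mathcal M_{ij}=*\},$$ and $\mathcal M$ is said to have full column rank if $\operatorname{rank} M=q$ for every $M\in\mathcal P(\mathcal M)$. Pattern matrices of equal size are added entrywise, with $0+a=a+0=a$ for $a\in\{0,*,?\}$ and $*+*=*+{?}={?}+*={?}+{?}={?}$. Let $\mathcal I$ be the $n\times n$ pattern matrix with $*$ on the diagonal and $0$ elsewhere. Let $\mathcal U$ be a class of input functions $u:[0,\infty)\to\mathbb R^m$ that contains all smooth functions and whose members are locally integrable and right-continuous on $[0,\infty)$ (for instance the smooth, the continuous, or the right-continuous piecewise continuous functions). For real matrices $A\in\mathbb R^{n\times n}$, $B\in\mathbb R^{n\times m}$, $C\in\mathbb R^{p\times n}$, $D\in\mathbb R^{p\times m}$, let $y(t;x_0,u)$ denote the output at time $t\ge 0$ of the system $$\dot x(t)=Ax(t)+Bu(t),\qquad y(t)=Cx(t)+Du(t),\qquad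 x(0)=x_0,$$ the differential equation being understood in its integrated form. The system $(A,B,C,D)$ is input-state observable if, for all $x_1,x_2\in\mathbb R^n$ and $u_1,u_2\in\mathcal U$, the equality $y(t;x_1,u_1)=y(t;x_2,u_2)$ for all $t\ge 0$ implies $x_1=x_2$ and $u_1(t)=u_2(t)$ for all $t\ge 0$. **Theorem.** Let $\mathcal A\in\{0,*,?\}^{n\times n}$, $\mathcal B\in\{0,*,?\}^{n\times m}$, $\mathcal C\in\{0,*,?\}^{p\times n}$ and $\mathcal D\in\{0,*,?\}^{p\times m}$. The structured system $(\mathcal A,\mathcal B,\mathcal C,\mathcal D)$ is strongly structurally input-state observable, i.e. $(A,B,C,D)$ is input-state observable for all $A\in\mathcal P(\mathcal A)$, $B\in\mathcal P(\mathcal B)$, $C\in\mathcal P(\mathcal C)$, $D\in\mathcal P(\mathcal D)$, if and only if both $$\begin{bmatrix}\mathcal A&\mathcal B\\ \mathcal C&\mathcal D\end{bmatrix}\quad\text{and}\quad\begin{bmatrix}\mathcal A+\mathcal I&\mathcal B\\ \mathcal C&\mathcal D\end{bmatrix}$$ have full column rank. -/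

import Mathlib

/-- The symbols `0`, `∗` (a nonzero real number) and `?` (an arbitrary real number). -/
inductive PatternSymbol where
  | zero
  | star
  | arb

namespace PatternSymbol

instance : Zero PatternSymbol := ⟨zero⟩

/-- The addition table of the symbols: `0` is neutral, and every other sum is `?`. -/
def add : PatternSymbol → PatternSymbol → PatternSymbol
  | zero, b => b
  | a, zero => a
  | star, star => arb
  | star, arb => arb
  | arb, star => arb
  | arb, arb => arb

instance : Add PatternSymbol := ⟨add⟩

end PatternSymbol

/-- A pattern matrix; sums of pattern matrices are entrywise (Mathlib's `Matrix` addition). -/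
abbrev PatternMatrix (ι κ : Type*) := Matrix ι κ PatternSymbol

namespace PatternMatrix

/-- The pattern class: the real matrices with zeros where the pattern has `0` and nonzero entries
where the pattern has `∗`. -/
def patternClass {ι κ : Type*} (P : PatternMatrix ι κ) : Set (Matrix ι κ ℝ) :=
  {M | ∀ i j, (P i j = PatternSymbol.zero → M i j = 0) ∧ (P i j = PatternSymbol.star → M i j ≠ 0)}

/-- The diagonal pattern matrix with `∗` on the diagonal and `0` elsewhere. -/
def diagStar (ι : Type*) [DecidableEq ι] : PatternMatrix ι ι :=
  Matrix.diagonal fun _ => PatternSymbol.star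

/-- A pattern matrix has full column rank if every real matrix in its pattern class does. -/
def HasFullColumnRank {ι κ : Type*} [Fintype κ] (P : PatternMatrix ι κ) : Prop :=
  ∀ M ∈ P.patternClass, M.rank = Fintype.card κ

end PatternMatrix

/-- A class of input functions `u : [0, ∞) → ℝᵐ` (represented by functions on `ℝ` of which only the
values at `t ≥ 0` are used): it contains the restrictions of all smooth functions, and its members
are locally integrable and right-continuous on `[0, ∞)`. Examples are the smooth, the `C^k`, the
continuous, and the right-continuous piecewise continuous functions. -/
structure IsInputClass {m : ℕ} (U : Set (ℝ → Fin m → ℝ)) : Prop where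
  smooth_mem : ∀ u : ℝ → Fin m → ℝ, ContDiff ℝ (⊤ : ℕ∞) u → u ∈ U
  locallyIntegrableOn : ∀ u ∈ U,
    MeasureTheory.LocallyIntegrableOn u (Set.Ici 0) MeasureTheory.volume
  right_continuous : ∀ u ∈ U, ∀ t : ℝ, 0 ≤ t → ContinuousWithinAt u (Set.Ici t) t

/-- `x` is the state trajectory on `[0, ∞)` of `ẋ = A x + B u` with `x(0) = x₀`, i.e. the
(Carathéodory) solution of the integrated equation. -/
def IsStateTrajectory {n m : ℕ} (A : Matrix (Fin n) (Fin n) ℝ) (B : Matrix (Fin n) (Fin m) ℝ)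
    (x₀ : Fin n → ℝ) (u : ℝ → Fin m → ℝ) (x : ℝ → Fin n → ℝ) : Prop :=
  ContinuousOn x (Set.Ici 0) ∧
    ∀ t : ℝ, 0 ≤ t → x t = x₀ + ∫ s in (0 : ℝ)..t, (A.mulVec (x s) + B.mulVec (u s))

/-- `y` is the output trajectory on `[0, ∞)` of `ẋ = A x + B u`, `y = C x + D u` for the initial
condition `x(0) = x₀` and the input `u`. -/
def IsOutputTrajectory {n m p : ℕ} (A : Matrix (Fin n) (Fin n) ℝ) (B : Matrix (Fin n) (Fin m) ℝ)
    (C : Matrix (Fin p) (Fin n) ℝ) (D : Matrix (Fin p) (Fin m) ℝ)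
    (x₀ : Fin n → ℝ) (u : ℝ → Fin m → ℝ) (y : ℝ → Fin p → ℝ) : Prop :=
  ∃ x : ℝ → Fin n → ℝ, IsStateTrajectory A B x₀ u x ∧
    ∀ t : ℝ, 0 ≤ t → y t = C.mulVec (x t) + D.mulVec (u t)

/-- Input-state observability of `(A, B, C, D)` for inputs in `U`: equal outputs for all `t ≥ 0`
force equal initial conditions and equal inputs for all `t ≥ 0`. -/
def IsInputStateObservable {n m p : ℕ} (U : Set (ℝ → Fin m → ℝ))
    (A : Matrix (Fin n) (Fin n) ℝ) (B : Matrix (Fin n) (Fin m) ℝ)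
    (C : Matrix (Fin p) (Fin n) ℝ) (D : Matrix (Fin p) (Fin m) ℝ) : Prop :=
  ∀ (x₁ x₂ : Fin n → ℝ), ∀ u₁ ∈ U, ∀ u₂ ∈ U, ∀ (y₁ y₂ : ℝ → Fin p → ℝ),
    IsOutputTrajectory A B C D x₁ u₁ y₁ → IsOutputTrajectory A B C D x₂ u₂ y₂ →
    (∀ t : ℝ, 0 ≤ t → y₁ t = y₂ t) →
    x₁ = x₂ ∧ ∀ t : ℝ, 0 ≤ t → u₁ t = u₂ t

/-- Strong structural input-state observability of the structured system `(𝒜, ℬ, 𝒞, 𝒟)`: all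
systems in the family are input-state observable. -/
def IsStronglyStructurallyInputStateObservable {n m p : ℕ} (U : Set (ℝ → Fin m → ℝ))
    (𝒜 : PatternMatrix (Fin n) (Fin n)) (ℬ : PatternMatrix (Fin n) (Fin m))
    (𝒞 : PatternMatrix (Fin p) (Fin n)) (𝒟 : PatternMatrix (Fin p) (Fin m)) : Prop :=
  ∀ A ∈ 𝒜.patternClass, ∀ B ∈ ℬ.patternClass, ∀ C ∈ 𝒞.patternClass, ∀ D ∈ 𝒟.patternClass,
    IsInputStateObservable U A B C D

open Matrix

/-! Both conditions say that no system of the family has an invariant zero: a scalar `c` and `(v, w)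
≠ 0` with `A v + B w = c v`, `C v + D w = 0`.

Necessity: a real zero yields the trajectory `exp (c t) (v, w)` with zero output. Taking `c = 0`
gives the first rank condition. For the second, `c = -1` suffices, since nonzero row scaling
preserves kernels and brings a matrix obeying `𝒜 + ℐ` to the form `A + 1`.

Sufficiency: full column rank depends only on supports of kernel vectors, so it passes from `ℝ` to
`ℂ` (`exists_row_annihilating_support`). As `A - c` obeys `𝒜` for `c = 0` and `𝒜 + ℐ` otherwise,
there are no complex zeros. A nonzero trajectory with zero output would produce one, as an
eigenvector on the span of its states (`eq_zero_of_output_eq_zero`). -/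

theorem Matrix.rank_eq_card_iff_forall_mulVec_eq_zero {ι κ : Type*} [Fintype κ]
    (M : Matrix ι κ ℝ) : M.rank = Fintype.card κ ↔ ∀ v, M *ᵥ v = 0 → v = 0 := by
  have h := M.mulVecLin.finrank_range_add_finrank_ker
  rw [Module.finrank_fintype_fun_eq_card] at h
  have hker : (∀ v, M *ᵥ v = 0 → v = 0) ↔ LinearMap.ker M.mulVecLin = ⊥ := by
    rw [LinearMap.ker_eq_bot']
    rfl
  rw [hker, ← Submodule.finrank_eq_zero (R := ℝ), Matrix.rank]
  omega

/-! ### Kernels of matrices obeying a pattern -/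

namespace PatternSymbol

theorem add_zero' (a : PatternSymbol) : a + 0 = a := by cases a <;> rfl

theorem add_star_eq (a : PatternSymbol) :
    (a = zero ∧ a + star = star) ∨ (a ≠ zero ∧ a + star = arb) := by
  cases a
  · exact Or.inl ⟨rfl, rfl⟩
  · exact Or.inr ⟨nofun, rfl⟩
  · exact Or.inr ⟨nofun, rfl⟩

end PatternSymbol

namespace PatternMatrix

/-- If a row over a field, obeying a row of symbols, annihilates `z`, then some real row obeying the
same symbols annihilates the indicator of the support of `z`. -/
theorem exists_row_annihilating_support {κ 𝕜 : Type*} [Fintype κ] [Field 𝕜]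
    (p : κ → PatternSymbol) (r z : κ → 𝕜)
    (hr : ∀ j, (p j = PatternSymbol.zero → r j = 0) ∧ (p j = PatternSymbol.star → r j ≠ 0))
    (hz : ∑ j, r j * z j = 0) (χ : κ → ℝ) (hχ : ∀ j, (z j = 0 ∧ χ j = 0) ∨ (z j ≠ 0 ∧ χ j = 1)) :
    ∃ q : κ → ℝ,
      (∀ j, (p j = PatternSymbol.zero → q j = 0) ∧ (p j = PatternSymbol.star → q j ≠ 0)) ∧
      ∑ j, q j * χ j = 0 := by
  classical
  let q₀ : κ → ℝ := fun j => if p j = PatternSymbol.star then 1 else 0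
  have hq₀ : ∀ j, (p j = PatternSymbol.zero → q₀ j = 0) ∧
      (p j = PatternSymbol.star → q₀ j ≠ 0) := fun j =>
    ⟨fun h => by simp [q₀, h], fun h => by simp [q₀, h]⟩
  have hχ0 : ∀ j, 0 ≤ q₀ j * χ j := fun j => by
    have h1 : 0 ≤ q₀ j := by simp only [q₀]; split_ifs <;> norm_num
    have h2 : 0 ≤ χ j := by rcases hχ j with h | h <;> rw [h.2]; exact zero_le_one
    exact mul_nonneg h1 h2
  -- Solve for the entry at `j`. If it is starred, a second star in the support makes the sum of the
  -- others positive, so the solution is nonzero.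
  have key : ∀ j, z j ≠ 0 → p j ≠ PatternSymbol.zero →
      (p j = PatternSymbol.star → ∃ k, k ≠ j ∧ z k ≠ 0 ∧ p k = PatternSymbol.star) →
      ∃ q : κ → ℝ,
        (∀ j, (p j = PatternSymbol.zero → q j = 0) ∧ (p j = PatternSymbol.star → q j ≠ 0)) ∧
        ∑ j, q j * χ j = 0 := by
    intro j hzj hpj hk
    have hχj : χ j = 1 := by rcases hχ j with h | h; exacts [absurd h.1 hzj, h.2]
    refine ⟨Function.update q₀ j (-∑ i ∈ Finset.univ.erase j, q₀ i * χ i), fun i => ?_, ?_⟩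
    · rcases eq_or_ne i j with rfl | hij
      · refine ⟨fun h => absurd h hpj, fun h => ?_⟩
        obtain ⟨k, hki, hzk, hpk⟩ := hk h
        have hχk : χ k = 1 := by rcases hχ k with h | h; exacts [absurd h.1 hzk, h.2]
        have : q₀ k * χ k ≤ ∑ i ∈ Finset.univ.erase i, q₀ i * χ i :=
          Finset.single_le_sum (f := fun i => q₀ i * χ i) (fun i _ => hχ0 i)
            (Finset.mem_erase.2 ⟨hki, Finset.mem_univ k⟩)
        have h1 : q₀ k * χ k = 1 := by simp [q₀, hpk, hχk]
        rw [Function.update_self]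
        linarith
      · rw [Function.update_of_ne hij]
        exact hq₀ i
    · rw [← Finset.add_sum_erase _ _ (Finset.mem_univ j), Function.update_self, hχj, mul_one,
        neg_add_eq_zero]
      exact Finset.sum_congr rfl fun i hi => by
        rw [Function.update_of_ne (Finset.ne_of_mem_erase hi)]
  by_cases h1 : ∃ j, z j ≠ 0 ∧ p j = PatternSymbol.arb
  · obtain ⟨j, hzj, hpj⟩ := h1
    exact key j hzj (by simp [hpj]) (by simp [hpj])
  by_cases h2 : ∃ j, z j ≠ 0 ∧ p j = PatternSymbol.star
  · obtain ⟨j, hzj, hpj⟩ := h2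
    refine key j hzj (by simp [hpj]) fun _ => ?_
    -- A lone star in a support without `?` would leave `r j * z j ≠ 0` as the whole sum.
    by_contra hk
    push Not at h1 hk
    rw [Finset.sum_eq_single j (fun k _ hkj => ?_) (by simp)] at hz
    · exact mul_ne_zero ((hr j).2 hpj) hzj hz
    · by_cases hzk : z k = 0
      · rw [hzk, mul_zero]
      · cases hpk : p k with
        | zero => rw [(hr k).1 hpk, zero_mul]
        | star => exact absurd hpk (hk k hkj hzk)
        | arb => exact absurd hpk (h1 k hzk)
  · push Not at h2
    refine ⟨q₀, hq₀, Finset.sum_eq_zero fun j _ => ?_⟩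
    rcases hχ j with h | h
    · rw [h.2, mul_zero]
    · simp [q₀, h2 j h.1]

/-- Full column rank of a pattern matrix passes to matrices over any field that obey the pattern. -/
theorem HasFullColumnRank.eq_zero_of_mulVec_eq_zero {ι κ 𝕜 : Type*} [Fintype κ] [Field 𝕜]
    {P : PatternMatrix ι κ} (hP : P.HasFullColumnRank) (M : Matrix ι κ 𝕜)
    (hM : ∀ i j, (P i j = PatternSymbol.zero → M i j = 0) ∧ (P i j = PatternSymbol.star → M i j ≠ 0))
    (z : κ → 𝕜) (hz : M *ᵥ z = 0) : z = 0 := by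
  classical
  let χ : κ → ℝ := fun j => if z j = 0 then 0 else 1
  have hχ : ∀ j, (z j = 0 ∧ χ j = 0) ∨ (z j ≠ 0 ∧ χ j = 1) := fun j => by
    by_cases h : z j = 0 <;> simp [χ, h]
  choose N hN hNχ using fun i =>
    exists_row_annihilating_support (P i) (M i) z (hM i) (congrFun hz i) χ hχ
  have h0 := (rank_eq_card_iff_forall_mulVec_eq_zero (of N)).1 (hP (of N) hN) χ (funext hNχ)
  funext j
  rcases hχ j with h | h
  · exact h.1
  · rw [h0] at h
    simp at h

theorem mem_patternClass_fromBlocks {ι₁ ι₂ κ₁ κ₂ : Type*}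
    {𝒜 : PatternMatrix ι₁ κ₁} {ℬ : PatternMatrix ι₁ κ₂} {𝒞 : PatternMatrix ι₂ κ₁}
    {𝒟 : PatternMatrix ι₂ κ₂} {M : Matrix (ι₁ ⊕ ι₂) (κ₁ ⊕ κ₂) ℝ} :
    M ∈ patternClass (fromBlocks 𝒜 ℬ 𝒞 𝒟) ↔
      M.toBlocks₁₁ ∈ 𝒜.patternClass ∧ M.toBlocks₁₂ ∈ ℬ.patternClass ∧
      M.toBlocks₂₁ ∈ 𝒞.patternClass ∧ M.toBlocks₂₂ ∈ 𝒟.patternClass := by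
  simp only [patternClass, Set.mem_ofPred_eq, Sum.forall, fromBlocks_apply₁₁, fromBlocks_apply₁₂,
    fromBlocks_apply₂₁, fromBlocks_apply₂₂, toBlocks₁₁, toBlocks₁₂, toBlocks₂₁, toBlocks₂₂, of_apply,
    forall_and]
  tauto

theorem add_diagStar_apply_of_ne {ι : Type*} [DecidableEq ι] (𝒜 : PatternMatrix ι ι) {i j : ι}
    (h : i ≠ j) : (𝒜 + diagStar ι) i j = 𝒜 i j := by
  rw [Matrix.add_apply, diagStar, diagonal_apply_ne _ h, PatternSymbol.add_zero']

theorem add_diagStar_apply_self {ι : Type*} [DecidableEq ι] (𝒜 : PatternMatrix ι ι) (i : ι) :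
    (𝒜 + diagStar ι) i i = 𝒜 i i + PatternSymbol.star := by
  rw [Matrix.add_apply, diagStar, diagonal_apply_eq]

/-- A matrix obeying `𝒜 + ℐ` can be scaled by rows so that, minus the identity, it obeys `𝒜`. -/
theorem exists_row_scaling_sub_one_mem {ι : Type*} [DecidableEq ι] {𝒜 : PatternMatrix ι ι}
    {M : Matrix ι ι ℝ} (hM : M ∈ (𝒜 + diagStar ι).patternClass) :
    ∃ d : ι → ℝ, (∀ i, d i ≠ 0) ∧ (of fun i j => d i * M i j) - 1 ∈ 𝒜.patternClass := by
  -- For a `0` of `𝒜` the scaled diagonal entry must be 1; for a `∗` it must differ from 1, so one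
  -- of the factors 1 and 2 works.
  have hd : ∀ i, ∃ d : ℝ, d ≠ 0 ∧ (𝒜 i i = PatternSymbol.zero → d * M i i = 1) ∧
      (𝒜 i i = PatternSymbol.star → d * M i i ≠ 1) := fun i => by
    have h := hM i i
    rw [add_diagStar_apply_self] at h
    rcases PatternSymbol.add_star_eq (𝒜 i i) with ⟨h0, h1⟩ | ⟨h0, h1⟩
    · have hne := h.2 h1
      exact ⟨(M i i)⁻¹, inv_ne_zero hne, fun _ => inv_mul_cancel₀ hne, by simp [h0]⟩
    · by_cases hone : M i i = 1
      · exact ⟨2, two_ne_zero, fun h => absurd h h0, fun _ => by rw [hone]; norm_num⟩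
      · exact ⟨1, one_ne_zero, fun h => absurd h h0, fun _ => by rwa [one_mul]⟩
  choose d hd0 hd1 hd2 using hd
  refine ⟨d, hd0, fun i j => ?_⟩
  rcases eq_or_ne i j with rfl | hij
  · simp only [Matrix.sub_apply, of_apply, one_apply_eq]
    exact ⟨fun h => sub_eq_zero.2 (hd1 i h), fun h => sub_ne_zero.2 (hd2 i h)⟩
  · have h := hM i j
    rw [add_diagStar_apply_of_ne 𝒜 hij] at h
    simp only [Matrix.sub_apply, of_apply, one_apply_ne hij, sub_zero]
    exact ⟨fun h0 => by rw [h.1 h0, mul_zero], fun h0 => mul_ne_zero (hd0 i) (h.2 h0)⟩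

theorem row_scaling_mem {ι κ : Type*} {P : PatternMatrix ι κ} {M : Matrix ι κ ℝ}
    (hM : M ∈ P.patternClass) {d : ι → ℝ} (hd : ∀ i, d i ≠ 0) :
    (of fun i j => d i * M i j) ∈ P.patternClass := fun i j =>
  ⟨fun h => by simp [(hM i j).1 h], fun h => mul_ne_zero (hd i) ((hM i j).2 h)⟩

end PatternMatrix

/-! ### Exponential trajectories from real invariant zeros -/

section Necessity

variable {n m p : ℕ} {U : Set (ℝ → Fin m → ℝ)}
  {A : Matrix (Fin n) (Fin n) ℝ} {B : Matrix (Fin n) (Fin m) ℝ}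
  {C : Matrix (Fin p) (Fin n) ℝ} {D : Matrix (Fin p) (Fin m) ℝ}

/-- An input-state observable system has no real invariant zeros. -/
theorem IsInputStateObservable.eq_zero_of_invariantZero (hU : IsInputClass U)
    (h : IsInputStateObservable U A B C D) (c : ℝ) (v : Fin n → ℝ) (w : Fin m → ℝ)
    (hA : A *ᵥ v + B *ᵥ w = c • v) (hC : C *ᵥ v + D *ᵥ w = 0) : v = 0 ∧ w = 0 := by
  have hexp : ContDiff ℝ (⊤ : ℕ∞) fun t : ℝ => Real.exp (c * t) :=
    Real.contDiff_exp.comp (contDiff_const.mul contDiff_id)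
  have hout : IsOutputTrajectory A B C D v (fun t => Real.exp (c * t) • w) 0 := by
    refine ⟨fun t => Real.exp (c * t) • v,
      ⟨(hexp.continuous.smul continuous_const).continuousOn, fun t _ => ?_⟩, fun t _ => ?_⟩
    · have hder : ∀ s : ℝ, HasDerivAt (fun t => Real.exp (c * t) • v)
          (A *ᵥ (Real.exp (c * s) • v) + B *ᵥ (Real.exp (c * s) • w)) s := fun s => by
        have h1 : HasDerivAt (fun t => Real.exp (c * t)) (Real.exp (c * s) * (c * 1)) s :=
          ((hasDerivAt_id s).const_mul c).exp
        refine (h1.smul_const v).congr_deriv ?_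
        rw [mulVec_smul, mulVec_smul, ← smul_add, hA, smul_smul, mul_one]
      have hcont : Continuous fun s : ℝ =>
          A *ᵥ (Real.exp (c * s) • v) + B *ᵥ (Real.exp (c * s) • w) := by
        simp only [mulVec_smul]
        exact (hexp.continuous.smul continuous_const).add (hexp.continuous.smul continuous_const)
      rw [intervalIntegral.integral_eq_sub_of_hasDerivAt (fun s _ => hder s)
        (hcont.intervalIntegrable 0 t)]
      simp
    · simp only [mulVec_smul, ← smul_add, hC, smul_zero, Pi.zero_apply]
  have hzero : IsOutputTrajectory A B C D 0 0 0 :=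
    ⟨0, ⟨continuousOn_const, fun t _ => by simp⟩, fun t _ => by simp⟩
  obtain ⟨hv, hw⟩ := h v 0 _ (hU.smooth_mem _ (hexp.smul contDiff_const)) 0
    (hU.smooth_mem _ contDiff_const) 0 0 hout hzero fun _ _ => rfl
  exact ⟨hv, by simpa using hw 0 le_rfl⟩

end Necessity

theorem Matrix.fromBlocks_mulVec_eq_zero_iff {R ι₁ ι₂ κ₁ κ₂ : Type*} [NonUnitalNonAssocSemiring R]
    [Fintype κ₁] [Fintype κ₂] (A : Matrix ι₁ κ₁ R) (B : Matrix ι₁ κ₂ R) (C : Matrix ι₂ κ₁ R)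
    (D : Matrix ι₂ κ₂ R) (v : κ₁ ⊕ κ₂ → R) :
    fromBlocks A B C D *ᵥ v = 0 ↔ A *ᵥ (v ∘ Sum.inl) + B *ᵥ (v ∘ Sum.inr) = 0 ∧
      C *ᵥ (v ∘ Sum.inl) + D *ᵥ (v ∘ Sum.inr) = 0 := by
  rw [fromBlocks_mulVec]
  simp [funext_iff]

/-! ### Rank conditions and invariant zeros -/

section Structured

variable {n m p : ℕ} {U : Set (ℝ → Fin m → ℝ)}
  {𝒜 : PatternMatrix (Fin n) (Fin n)} {ℬ : PatternMatrix (Fin n) (Fin m)}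
  {𝒞 : PatternMatrix (Fin p) (Fin n)} {𝒟 : PatternMatrix (Fin p) (Fin m)}

theorem IsStronglyStructurallyInputStateObservable.hasFullColumnRank (hU : IsInputClass U)
    (h : IsStronglyStructurallyInputStateObservable U 𝒜 ℬ 𝒞 𝒟) :
    PatternMatrix.HasFullColumnRank (fromBlocks 𝒜 ℬ 𝒞 𝒟) := by
  intro M hM
  obtain ⟨hA, hB, hC, hD⟩ := PatternMatrix.mem_patternClass_fromBlocks.1 hM
  rw [rank_eq_card_iff_forall_mulVec_eq_zero]
  intro v hv
  rw [← fromBlocks_toBlocks M, fromBlocks_mulVec_eq_zero_iff] at hv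
  obtain ⟨h1, h2⟩ := (h _ hA _ hB _ hC _ hD).eq_zero_of_invariantZero hU 0 _ _
    (by rw [hv.1, zero_smul]) hv.2
  rw [← Sum.elim_comp_inl_inr v, h1, h2, Sum.elim_zero_zero]

theorem IsStronglyStructurallyInputStateObservable.hasFullColumnRank_add_diagStar
    (hU : IsInputClass U) (h : IsStronglyStructurallyInputStateObservable U 𝒜 ℬ 𝒞 𝒟) :
    PatternMatrix.HasFullColumnRank
      (fromBlocks (𝒜 + PatternMatrix.diagStar (Fin n)) ℬ 𝒞 𝒟) := by
  intro M hM
  obtain ⟨hA, hB, hC, hD⟩ := PatternMatrix.mem_patternClass_fromBlocks.1 hM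
  obtain ⟨d, hd, hA'⟩ := PatternMatrix.exists_row_scaling_sub_one_mem hA
  rw [rank_eq_card_iff_forall_mulVec_eq_zero]
  intro v hv
  rw [← fromBlocks_toBlocks M, fromBlocks_mulVec_eq_zero_iff] at hv
  have hscale : ∀ {k : ℕ} (N : Matrix (Fin n) (Fin k) ℝ) (x : Fin k → ℝ),
      (of fun i j => d i * N i j) *ᵥ x = d * (N *ᵥ x) := fun N x => by
    funext i
    simp [mulVec, dotProduct, Finset.mul_sum, mul_assoc]
  obtain ⟨h1, h2⟩ := (h _ hA' _ (PatternMatrix.row_scaling_mem hB hd) _ hC _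
    hD).eq_zero_of_invariantZero hU (-1) _ _ (by
      rw [sub_mulVec, hscale, hscale, one_mulVec, sub_add_eq_add_sub, ← mul_add, hv.1, mul_zero,
        zero_sub, neg_one_smul]) hv.2
  rw [← Sum.elim_comp_inl_inr v, h1, h2, Sum.elim_zero_zero]

/-- If both pattern matrices have full column rank, no system in the family has a complex invariant
zero. -/
theorem eq_zero_of_complex_invariantZero
    (h₁ : PatternMatrix.HasFullColumnRank (fromBlocks 𝒜 ℬ 𝒞 𝒟))
    (h₂ : PatternMatrix.HasFullColumnRank
      (fromBlocks (𝒜 + PatternMatrix.diagStar (Fin n)) ℬ 𝒞 𝒟))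
    {A : Matrix (Fin n) (Fin n) ℝ} (hA : A ∈ 𝒜.patternClass)
    {B : Matrix (Fin n) (Fin m) ℝ} (hB : B ∈ ℬ.patternClass)
    {C : Matrix (Fin p) (Fin n) ℝ} (hC : C ∈ 𝒞.patternClass)
    {D : Matrix (Fin p) (Fin m) ℝ} (hD : D ∈ 𝒟.patternClass)
    (c : ℂ) (v : Fin n → ℂ) (w : Fin m → ℂ)
    (hAB : A.map Complex.ofRealHom *ᵥ v + B.map Complex.ofRealHom *ᵥ w = c • v)
    (hCD : C.map Complex.ofRealHom *ᵥ v + D.map Complex.ofRealHom *ᵥ w = 0) :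
    v = 0 ∧ w = 0 := by
  have hmap : ∀ {k l : ℕ} {P : PatternMatrix (Fin k) (Fin l)} {M : Matrix (Fin k) (Fin l) ℝ},
      M ∈ P.patternClass → ∀ i j, (P i j = PatternSymbol.zero → M.map Complex.ofRealHom i j = 0) ∧
        (P i j = PatternSymbol.star → M.map Complex.ofRealHom i j ≠ 0) := fun hM i j => by
    simpa using hM i j
  have hker : fromBlocks (A.map Complex.ofRealHom - c • 1) (B.map Complex.ofRealHom)
      (C.map Complex.ofRealHom) (D.map Complex.ofRealHom) *ᵥ Sum.elim v w = 0 := by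
    rw [fromBlocks_mulVec_eq_zero_iff, Sum.elim_comp_inl, Sum.elim_comp_inr]
    refine ⟨?_, hCD⟩
    rw [sub_mulVec, smul_mulVec, one_mulVec, sub_add_eq_add_sub, hAB, sub_self]
  have hzero : Sum.elim v w = 0 := by
    by_cases hc : c = 0
    · refine h₁.eq_zero_of_mulVec_eq_zero _ ?_ _ hker
      rw [hc, zero_smul, sub_zero]
      rintro (i | i) (j | j)
      exacts [hmap hA i j, hmap hB i j, hmap hC i j, hmap hD i j]
    · refine h₂.eq_zero_of_mulVec_eq_zero _ ?_ _ hker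
      rintro (i | i) (j | j)
      · rw [fromBlocks_apply₁₁, fromBlocks_apply₁₁]
        rcases eq_or_ne i j with rfl | hij
        · rw [PatternMatrix.add_diagStar_apply_self]
          -- A diagonal `∗` of `𝒜 + ℐ` arises only where `𝒜 i i` is `0`; the entry there is `-c ≠
          -- 0`.
          rcases PatternSymbol.add_star_eq (𝒜 i i) with ⟨h0, h1⟩ | ⟨h0, h1⟩
          · rw [h1]
            exact ⟨nofun, fun _ => by simp [(hA i i).1 h0, hc]⟩
          · rw [h1]
            exact ⟨nofun, nofun⟩
        · rw [PatternMatrix.add_diagStar_apply_of_ne 𝒜 hij, Matrix.sub_apply, Matrix.smul_apply,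
            one_apply_ne hij, smul_zero, sub_zero]
          exact hmap hA i j
      exacts [hmap hB i j, hmap hC i j, hmap hD i j]
  exact ⟨funext fun i => congrFun hzero (Sum.inl i), funext fun i => congrFun hzero (Sum.inr i)⟩

end Structured

/-! ### Trajectories with zero output -/

section Sufficiency

variable {n m p : ℕ} {A : Matrix (Fin n) (Fin n) ℝ} {B : Matrix (Fin n) (Fin m) ℝ}
  {C : Matrix (Fin p) (Fin n) ℝ} {D : Matrix (Fin p) (Fin m) ℝ}

/-- A right derivative of a curve in a finite-dimensional space lies in every subspace that contains the curve. -/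
theorem HasDerivWithinAt.mem_submodule {E : Type*} [NormedAddCommGroup E] [NormedSpace ℝ E]
    [NormedSpace ℂ E] [IsScalarTower ℝ ℂ E] [FiniteDimensional ℂ E] {V : Submodule ℂ E}
    {f : ℝ → E} {f' : E} {t : ℝ} (hf : HasDerivWithinAt f f' (Set.Ici t) t)
    (hV : ∀ s, t ≤ s → f s ∈ V) : f' ∈ V := by
  have hclosed : IsClosed (V : Set E) := V.closed_of_finiteDimensional
  rw [hasDerivWithinAt_iff_tendsto_slope, Set.Ici_sdiff_left] at hf
  refine hclosed.mem_of_tendsto hf ?_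
  filter_upwards [self_mem_nhdsWithin] with s hs
  rw [slope_def_module]
  exact (V.restrictScalars ℝ).smul_mem _ (V.sub_mem (hV s (le_of_lt hs)) (hV t le_rfl))

/-- A system without complex invariant zeros has no nonzero trajectory with zero output. -/
theorem eq_zero_of_output_eq_zero
    (hinj : ∀ (c : ℂ) (v : Fin n → ℂ) (w : Fin m → ℂ),
      A.map Complex.ofRealHom *ᵥ v + B.map Complex.ofRealHom *ᵥ w = c • v →
      C.map Complex.ofRealHom *ᵥ v + D.map Complex.ofRealHom *ᵥ w = 0 → v = 0 ∧ w = 0)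
    {x : ℝ → Fin n → ℝ} {u : ℝ → Fin m → ℝ}
    (hx : ∀ t, 0 ≤ t → HasDerivWithinAt x (A *ᵥ x t + B *ᵥ u t) (Set.Ici t) t)
    (hy : ∀ t, 0 ≤ t → C *ᵥ x t + D *ᵥ u t = 0) (t : ℝ) (ht : 0 ≤ t) :
    x t = 0 ∧ u t = 0 := by
  -- Complexification ensures that an eigenvalue exists below.
  let ξ : ℝ → Fin n → ℂ := fun t i => Complex.ofRealHom (x t i)
  let υ : ℝ → Fin m → ℂ := fun t i => Complex.ofRealHom (u t i)
  let L : ((Fin n → ℂ) × (Fin m → ℂ)) →ₗ[ℂ] (Fin n → ℂ) :=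
    (A.map Complex.ofRealHom).mulVecLin.coprod (B.map Complex.ofRealHom).mulVecLin
  let K : ((Fin n → ℂ) × (Fin m → ℂ)) →ₗ[ℂ] (Fin p → ℂ) :=
    (C.map Complex.ofRealHom).mulVecLin.coprod (D.map Complex.ofRealHom).mulVecLin
  have hmap : ∀ {k l l' : ℕ} (M : Matrix (Fin k) (Fin l) ℝ) (N : Matrix (Fin k) (Fin l') ℝ)
      (v : Fin l → ℝ) (w : Fin l' → ℝ),
      M.map Complex.ofRealHom *ᵥ (fun i => Complex.ofRealHom (v i)) +
        N.map Complex.ofRealHom *ᵥ (fun i => Complex.ofRealHom (w i)) =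
      fun i => Complex.ofRealHom ((M *ᵥ v + N *ᵥ w) i) := fun M N v w => by
    funext i
    rw [Pi.add_apply, Pi.add_apply, map_add, RingHom.map_mulVec, RingHom.map_mulVec]
    rfl
  have hL : ∀ t, 0 ≤ t → HasDerivWithinAt ξ (L (ξ t, υ t)) (Set.Ici t) t := fun t ht => by
    rw [hasDerivWithinAt_pi]
    intro i
    have h1 := (hasDerivWithinAt_pi.1 (hx t ht) i).ofReal_comp
    exact h1.congr_deriv (congrFun (hmap A B (x t) (u t)) i).symm
  have hK : ∀ t, 0 ≤ t → K (ξ t, υ t) = 0 := fun t ht => by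
    refine (hmap C D (x t) (u t)).trans ?_
    rw [hy t ht]
    funext i
    simp
  let W : Submodule ℂ ((Fin n → ℂ) × (Fin m → ℂ)) :=
    Submodule.span ℂ ((fun t => (ξ t, υ t)) '' Set.Ici 0)
  let V : Submodule ℂ (Fin n → ℂ) := W.map (LinearMap.fst ℂ _ _)
  have hW : ∀ t, 0 ≤ t → (ξ t, υ t) ∈ W := fun t ht =>
    Submodule.subset_span ⟨t, ht, rfl⟩
  have hV : ∀ t, 0 ≤ t → ξ t ∈ V := fun t ht => ⟨_, hW t ht, rfl⟩
  -- On the generators, `L` gives the right derivative of `ξ`, which stays in `V`.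
  have hLV : ∀ z ∈ W, L z ∈ V := by
    refine show W ≤ V.comap L from Submodule.span_le.2 ?_
    rintro _ ⟨t, ht, rfl⟩
    exact (hL t ht).mem_submodule fun s hs => hV s (le_trans ht hs)
  have hKW : ∀ z ∈ W, K z = 0 := by
    refine show W ≤ LinearMap.ker K from Submodule.span_le.2 ?_
    rintro _ ⟨t, ht, rfl⟩
    exact hK t ht
  have hbot : V = ⊥ := by
    by_contra hne
    have : Nontrivial V := Submodule.nontrivial_iff_ne_bot.2 hne
    -- The section `s` attaches an input linearly to each state in `V`, a feedback under which `V`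
    -- is invariant. An eigenvector of the closed loop `T` is an invariant zero.
    obtain ⟨s, hs⟩ := ((LinearMap.fst ℂ (Fin n → ℂ) (Fin m → ℂ)).submoduleMap
      W).exists_rightInverse_of_surjective
        (LinearMap.range_eq_top.2 (LinearMap.submoduleMap_surjective _ _))
    let T : Module.End ℂ V := ((L.comp W.subtype).codRestrict V fun z => hLV z z.2).comp s
    obtain ⟨c, hc⟩ := Module.End.exists_eigenvalue T
    obtain ⟨v, hv⟩ := hc.exists_hasEigenvector
    have h1 : (s v : (Fin n → ℂ) × (Fin m → ℂ)).1 = v :=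
      congrArg Subtype.val (LinearMap.congr_fun hs v)
    have h2 : L (s v) = c • (v : Fin n → ℂ) := congrArg Subtype.val hv.apply_eq_smul
    have h3 := (hinj c _ _ (h2.trans (congrArg (c • ·) h1.symm)) (hKW _ (s v).2)).1
    exact hv.2 (Subtype.ext (h1.symm.trans h3))
  have hξ : ξ t = 0 := (Submodule.mem_bot ℂ).1 (hbot ▸ hV t ht)
  -- With zero state, the input satisfies the zero equations for `c = 0`.
  have hLt : L (ξ t, υ t) = 0 := (Submodule.mem_bot ℂ).1 (hbot ▸ hLV _ (hW t ht))
  have hυ : υ t = 0 := (hinj 0 _ _ (hLt.trans (zero_smul ℂ _).symm) (hK t ht)).2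
  exact ⟨funext fun i => Complex.ofReal_eq_zero.1 (congrFun hξ i),
    funext fun i => Complex.ofReal_eq_zero.1 (congrFun hυ i)⟩

theorem Matrix.continuous_mulVec_right {k l : ℕ} (M : Matrix (Fin k) (Fin l) ℝ) :
    Continuous fun v : Fin l → ℝ => M *ᵥ v :=
  M.mulVecLin.continuous_of_finiteDimensional

/-- A state trajectory for a right-continuous input has the right derivative `A x + B u`. -/
theorem IsStateTrajectory.hasDerivWithinAt {x₀ : Fin n → ℝ} {u : ℝ → Fin m → ℝ}
    {x : ℝ → Fin n → ℝ} (hx : IsStateTrajectory A B x₀ u x)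
    (hu : MeasureTheory.LocallyIntegrableOn u (Set.Ici 0) MeasureTheory.volume)
    (hu' : ∀ t : ℝ, 0 ≤ t → ContinuousWithinAt u (Set.Ici t) t) (t : ℝ) (ht : 0 ≤ t) :
    HasDerivWithinAt x (A *ᵥ x t + B *ᵥ u t) (Set.Ici t) t := by
  have hint : ∀ b : ℝ, 0 ≤ b → MeasureTheory.IntegrableOn (fun s => A *ᵥ x s + B *ᵥ u s)
      (Set.Icc 0 b) MeasureTheory.volume := fun b _ => by
    refine MeasureTheory.Integrable.add ?_ ?_
    · exact ((A.continuous_mulVec_right.comp_continuousOn hx.1).mono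
        Set.Icc_subset_Ici_self).integrableOn_compact isCompact_Icc
    · exact (LinearMap.toContinuousLinearMap B.mulVecLin).integrable_comp
        (hu.integrableOn_compact_subset Set.Icc_subset_Ici_self isCompact_Icc)
  have hcont : ContinuousWithinAt (fun s => A *ᵥ x s + B *ᵥ u s) (Set.Ici t) t :=
    (A.continuous_mulVec_right.continuousAt.comp_continuousWithinAt
      ((hx.1 t ht).mono (Set.Ici_subset_Ici.2 ht))).add
    (B.continuous_mulVec_right.continuousAt.comp_continuousWithinAt (hu' t ht))
  have hmeas : StronglyMeasurableAtFilter (fun s => A *ᵥ x s + B *ᵥ u s)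
      (nhdsWithin t (Set.Ioi t)) MeasureTheory.volume :=
    ⟨Set.Ioc t (t + 1), Ioc_mem_nhdsGT (lt_add_one t),
      ((hint (t + 1) (by linarith)).mono_set fun s hs =>
        ⟨ht.trans hs.1.le, hs.2⟩).aestronglyMeasurable⟩
  -- Right-continuity of the integrand gives the right derivative at every `t`, not merely almost
  -- everywhere.
  have hder := (intervalIntegral.integral_hasDerivWithinAt_right
    ((intervalIntegrable_iff_integrableOn_Icc_of_le ht).2 (hint t ht)) hmeas
    (hcont.mono Set.Ioi_subset_Ici_self) (s := Set.Ici t)).const_add x₀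
  exact hder.congr (fun s hs => hx.2 s (ht.trans hs)) (hx.2 t ht)

/-- A system without complex invariant zeros is input-state observable. -/
theorem isInputStateObservable_of_no_invariantZero {U : Set (ℝ → Fin m → ℝ)} (hU : IsInputClass U)
    (hinj : ∀ (c : ℂ) (v : Fin n → ℂ) (w : Fin m → ℂ),
      A.map Complex.ofRealHom *ᵥ v + B.map Complex.ofRealHom *ᵥ w = c • v →
      C.map Complex.ofRealHom *ᵥ v + D.map Complex.ofRealHom *ᵥ w = 0 → v = 0 ∧ w = 0) :
    IsInputStateObservable U A B C D := by
  rintro x₁ x₂ u₁ hu₁ u₂ hu₂ y₁ y₂ ⟨ξ₁, hξ₁, hy₁⟩ ⟨ξ₂, hξ₂, hy₂⟩ hy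
  -- By linearity, the difference of the two trajectories has zero output.
  have hzero := eq_zero_of_output_eq_zero hinj (x := ξ₁ - ξ₂) (u := u₁ - u₂)
    (fun t ht => by
      refine ((hξ₁.hasDerivWithinAt (hU.locallyIntegrableOn u₁ hu₁)
        (hU.right_continuous u₁ hu₁) t ht).sub (hξ₂.hasDerivWithinAt
          (hU.locallyIntegrableOn u₂ hu₂) (hU.right_continuous u₂ hu₂) t ht)).congr_deriv ?_
      rw [Pi.sub_apply, Pi.sub_apply, mulVec_sub, mulVec_sub]
      abel)
    (fun t ht => by
      have h := hy t ht
      rw [hy₁ t ht, hy₂ t ht, ← sub_eq_zero] at h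
      rw [Pi.sub_apply, Pi.sub_apply, mulVec_sub, mulVec_sub, ← h]
      abel)
  refine ⟨?_, fun t ht => sub_eq_zero.1 (hzero t ht).2⟩
  have h0 := sub_eq_zero.1 (hzero 0 le_rfl).1
  rw [hξ₁.2 0 le_rfl, hξ₂.2 0 le_rfl] at h0
  simpa using h0

end Sufficiency

theorem mainTheorem4 {n m p : ℕ} (U : Set (ℝ → Fin m → ℝ)) (hU : IsInputClass U)
    (𝒜 : PatternMatrix (Fin n) (Fin n)) (ℬ : PatternMatrix (Fin n) (Fin m))
    (𝒞 : PatternMatrix (Fin p) (Fin n)) (𝒟 : PatternMatrix (Fin p) (Fin m)) :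
    IsStronglyStructurallyInputStateObservable U 𝒜 ℬ 𝒞 𝒟 ↔
      PatternMatrix.HasFullColumnRank (Matrix.fromBlocks 𝒜 ℬ 𝒞 𝒟) ∧
      PatternMatrix.HasFullColumnRank
        (Matrix.fromBlocks (𝒜 + PatternMatrix.diagStar (Fin n)) ℬ 𝒞 𝒟) :=
  ⟨fun h => ⟨h.hasFullColumnRank hU, h.hasFullColumnRank_add_diagStar hU⟩,
    fun h _ hA _ hB _ hC _ hD => isInputStateObservable_of_no_invariantZero hU
      (eq_zero_of_complex_invariantZero h.1 h.2 hA hB hC hD)⟩
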